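/- Let $M$, $N$ be oriented paracompact smooth Hausdorff manifolds of the same finite dimension $n$, let $r,s\ge 0$, and let $\mu:M\to N$ be a diffeomorphism (not assumed to preserve the orientations). *Definitions, for $M$ (and likewise for $N$).* $\Omega^n_c(M)$ is the space of compactly supported smooth $n$-forms and $\hat{\mathcal A}_0(M)=\{\omega\in\Omega^n_c(M):\int_M\omega=1\}$. $\hat{\mathcal B}(M)$ is the space of compactly supported transport operators, i.e. of compactly supported smooth sections $A$ of the bundle over $M\times M$ with fibre $L(T_pM,T_qM)$ over $(p,q)$. $\mathcal D'^r_s(M)$ is the space of $(r,s)$-tensor distributions, the continuous dual of the (LF)-space $\mathcal T^s_r(M)\otimes_{C^\infty(M)}\Omega^n_c(M)$ of compactly supported $(s,r)$-tensor densities. The basic space $\hat{\mathcal E}^r_s(M)$ consists of all maps $u$ assigning to each $(\omega,p,A)\in\hat{\mathcal A}_0(M)\times M\times\hat{\mathcal B}(M)$ an element $u(\omega,p,A)\in (T^r_s)_pM$ that are smooth in the sense that they map smooth curves to smooth curves in $T^r_sM$, where $\Omega^n_c(M)$ and $\hat{\mathcal B}(M)$ carry their (LF)-topologies. For $A\in\hat{\mathcal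 B}(M)$ let $A^s_r(p,q):(T^s_r)_pM\to(T^s_r)_qM$ be the linear map $$w_1\otimes\dots\otimes w_s\otimes\beta^1\otimes\dots\otimes\beta^r\mapsto A(p,q)w_1\otimes\dots\otimes A(p,q)w_s\otimes A(q,p)^{\mathrm{ad}}\beta^1\otimes\dots\otimes A(q,p)^{\mathrm{ad}}\beta^r .$$ For $v\in\mathcal D'^r_s(M)$, the map $\iota^r_s(v)$ assigns to $(\omega,p,A)$ the element of $(T^r_s)_pM$ determined by $$\iota^r_s(v)(\omega,p,A)\cdot t=\langle v,\ (A^s_r(p,\cdot)\,t)\otimes\omega\rangle\qquad (t\in (T^s_r)_pM).$$ *Actions of $\mu$.* On $n$-forms and on tensor densities, $\mu^*$ and $\mu_*=(\mu^{-1})^*$ are the natural actions on densities, the orientations being used to identify $n$-forms with densities: they are the usual pull-back and push-forward, multiplied by the locally constant sign that is $1$ where $\mu$ preserves and $-1$ where $\mu$ reverses the orientations. On transport operators, $((\mu,\mu)^*A)(p,q)=(T_q\mu)^{-1}\circ A(\mu p,\mu q)\circ T_p\mu$ and $(\mu,\mu)_*=(\mu^{-1},\mu^{-1})^*$. On tensor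 distributions, $\langle\mu^*v,\phi\rangle=\langle v,\mu_*\phi\rangle$. For a map $u$ that assigns an element of $(T^r_s)_qN$ to each $(\omega,q,A)\in\hat{\mathcal A}_0(N)\times N\times\hat{\mathcal B}(N)$ put $$(\hat\mu^*u)(\omega,p,A)=(T_{\mu(p)}\mu^{-1})^r_s\;u\big(\mu_*\omega,\ \mu(p),\ (\mu,\mu)_*A\big)\qquad\big((\omega,p,A)\in\hat{\mathcal A}_0(M)\times M\times\hat{\mathcal B}(M)\big).$$ *Claim.* $\hat\mu^*$ maps $\hat{\mathcal E}^r_s(N)$ into $\hat{\mathcal E}^r_s(M)$, and it commutes with the embeddings of tensor distributions: for all $v\in\mathcal D'^r_s(N)$, $$\hat\mu^*\,\iota^r_s(v)=\iota^r_s(\mu^*v),$$ that is, both sides agree at every $(\omega,p,A)\in\hat{\mathcal A}_0(M)\times M\times\hat{\mathcal B}(M)$. -/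

import Mathlib

open scoped Manifold ContDiff Topology

noncomputable section
namespace TensorDist

/-- The model space `ℝⁿ`. For a manifold `M` modelled on it, Mathlib defines every tangent space
`TangentSpace (𝓡 n) p` to be `ℝⁿ` as a type (with coordinate changes between the identifications),
so below `Vec n` stands for `T_pM` and `Covec n` for `T_p^*M`. -/
abbrev Vec (n : ℕ) : Type := EuclideanSpace ℝ (Fin n)
/-- Covectors. -/
abbrev Covec (n : ℕ) : Type := Vec n →L[ℝ] ℝ
/-- Alternating `n`-forms on an `n`-dimensional tangent space: the fibre of `Λⁿ T^*M`. -/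
abbrev Form (n : ℕ) : Type := Vec n [⋀^Fin n]→L[ℝ] ℝ
/-- The fibre of `T^r_s M ⊗ G`: multilinear maps taking `r` covectors and `s` vectors to `G`.
For `G = ℝ` this is the space of `(r,s)`-tensors, for `G = Form n` that of `(r,s)`-tensor densities
`T^r_s M ⊗ Λⁿ T^*M`. -/
abbrev TensorVal (n r s : ℕ) (G : Type) [NormedAddCommGroup G] [NormedSpace ℝ G] : Type :=
  ContinuousMultilinearMap ℝ (fun _ : Fin r => Covec n)
    (ContinuousMultilinearMap ℝ (fun _ : Fin s => Vec n) G)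

variable {n r s : ℕ} {G G' : Type} [NormedAddCommGroup G] [NormedSpace ℝ G]
  [NormedAddCommGroup G'] [NormedSpace ℝ G']

/-- Pull-back of an `n`-form along a linear map. -/
def formAct (L : Vec n →L[ℝ] Vec n) : Form n →L[ℝ] Form n :=
  ContinuousAlternatingMap.compContinuousLinearMapCLM L

/-- The action on `(r,s)`-tensors of `L : V → W` (on vector arguments) and `L' : W → V` (on covector
arguments), taking tensors over `W` to tensors over `V`: `(α, u) ↦ t (α ∘ L', L u)`. For `L` invertible
and `L' = L⁻¹` this is the pull-back of tensors along `L`. -/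
def tensorAct (L L' : Vec n →L[ℝ] Vec n) : TensorVal n r s G →L[ℝ] TensorVal n r s G :=
  (ContinuousLinearMap.compContinuousMultilinearMapL ℝ (fun _ : Fin r => Covec n) _ _
    (ContinuousMultilinearMap.compContinuousLinearMapL (F := G) (fun _ : Fin s => L))).comp
  (ContinuousMultilinearMap.compContinuousLinearMapL
    (fun _ : Fin r => (ContinuousLinearMap.compL ℝ (Vec n) (Vec n) ℝ).flip L'))

theorem tensorAct_apply (L L' : Vec n →L[ℝ] Vec n) (t : TensorVal n r s G)
    (β : Fin r → Covec n) (w : Fin s → Vec n) :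
    tensorAct L L' t β w = t (fun i => (β i).comp L') (fun j => L (w j)) := rfl

/-- Composition of a `G`-valued tensor with a linear map `G → G'`. -/
def tensorPost (g : G →L[ℝ] G') : TensorVal n r s G →L[ℝ] TensorVal n r s G' :=
  ContinuousLinearMap.compContinuousMultilinearMapL ℝ (fun _ : Fin r => Covec n) _ _
    (ContinuousLinearMap.compContinuousMultilinearMapL ℝ (fun _ : Fin s => Vec n) _ _ g)

theorem tensorPost_apply (g : G →L[ℝ] G') (t : TensorVal n r s G)
    (β : Fin r → Covec n) (w : Fin s → Vec n) :
    tensorPost g t β w = g (t β w) := rfl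

/-- The tangent map `T_p f : T_pX → T_{f p}Y`. -/
def der {X Y : Type*} [TopologicalSpace X] [ChartedSpace (Vec n) X] [TopologicalSpace Y]
    [ChartedSpace (Vec n) Y] (f : X → Y) (p : X) : Vec n →L[ℝ] Vec n :=
  mfderiv (𝓡 n) (𝓡 n) f p

theorem der_comp {X Y Z : Type*} [TopologicalSpace X] [ChartedSpace (Vec n) X] [TopologicalSpace Y]
    [ChartedSpace (Vec n) Y] [TopologicalSpace Z] [ChartedSpace (Vec n) Z] (g : Y → Z) (f : X → Y) (p : X) 
    (hg : MDifferentiableAt (𝓡 n) (𝓡 n) g (f p)) (hf : MDifferentiableAt (𝓡 n) (𝓡 n) f p) : 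
    der (g ∘ f) p = (der g (f p)).comp (der (n := n) f p) := mfderiv_comp p hg hf

theorem der_id {X : Type*} [TopologicalSpace X] [ChartedSpace (Vec n) X] (p : X) :
   der (n := n) (id : X → X) p = ContinuousLinearMap.id ℝ _ := mfderiv_id


/-- The multilinear map `β ↦ (u ↦ ∏ j, β j (u j))`. -/
def prodForm (V : Type) [NormedAddCommGroup V] [NormedSpace ℝ V] (k : ℕ) :
    ContinuousMultilinearMap ℝ (fun _ : Fin k => V →L[ℝ] ℝ)
      (ContinuousMultilinearMap ℝ (fun _ : Fin k => V) ℝ) :=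
  (ContinuousLinearMap.apply ℝ (ContinuousMultilinearMap ℝ (fun _ : Fin k => V) ℝ)
    (ContinuousMultilinearMap.mkPiAlgebra ℝ (Fin k) ℝ)).compContinuousMultilinearMap
    (ContinuousMultilinearMap.compContinuousLinearMapContinuousMultilinear ℝ
      (fun _ : Fin k => V) (fun _ : Fin k => ℝ) ℝ)

theorem prodForm_apply (V : Type) [NormedAddCommGroup V] [NormedSpace ℝ V] (k : ℕ)
    (β : Fin k → V →L[ℝ] ℝ) (u : Fin k → V) : prodForm V k β u = ∏ j, β j (u j) := by
  simp [prodForm]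

/-- The multilinear map `w ↦ (α ↦ ∏ i, α i (w i))`. -/
def prodVec (n k : ℕ) : ContinuousMultilinearMap ℝ (fun _ : Fin k => Vec n)
      (ContinuousMultilinearMap ℝ (fun _ : Fin k => Covec n) ℝ) :=
  (prodForm (Covec n) k).compContinuousLinearMap
    (fun _ => ContinuousLinearMap.apply ℝ ℝ)

theorem prodVec_apply (n k : ℕ) (w : Fin k → Vec n) (α : Fin k → Covec n) :
    prodVec n k w α = ∏ i, α i (w i) := by
  simp [prodVec, prodForm_apply]

/-- The decomposable `(s,r)`-tensor `w₁ ⊗ ⋯ ⊗ w_s ⊗ β¹ ⊗ ⋯ ⊗ β^r`. -/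
def decomp (w : Fin s → Vec n) (β : Fin r → Covec n) : TensorVal n s r ℝ :=
  ((1 : ℝ →L[ℝ] ℝ).smulRight (prodForm (Vec n) r β)).compContinuousMultilinearMap (prodVec n s w)

theorem decomp_apply (w : Fin s → Vec n) (β : Fin r → Covec n) (α : Fin s → Covec n)
    (u : Fin r → Vec n) : decomp w β α u = (∏ i, α i (w i)) * ∏ j, β j (u j) := by
  simp [decomp, prodForm_apply, prodVec_apply]

instance finiteDimensional_multilinear (V : Type) [NormedAddCommGroup V] [NormedSpace ℝ V]
    [FiniteDimensional ℝ V] (G : Type) [NormedAddCommGroup G] [NormedSpace ℝ G]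
    [FiniteDimensional ℝ G] (k : ℕ) :
    FiniteDimensional ℝ (ContinuousMultilinearMap ℝ (fun _ : Fin k => V) G) := by
  have : Module.Finite ℝ (MultilinearMap ℝ (fun _ : Fin k => V) G) :=
    Module.Finite.multilinearMap
  exact Module.Finite.of_injective
    (ContinuousMultilinearMap.toMultilinearMapLinear (R' := ℝ) (A := ℝ)
      (M₁ := fun _ : Fin k => V) (M₂ := G))
    ContinuousMultilinearMap.toMultilinearMap_injective

theorem continuous_of_finite {V : Type} [NormedAddCommGroup V] [NormedSpace ℝ V]
    [FiniteDimensional ℝ V] (ℓ : V →ₗ[ℝ] ℝ) : Continuous ℓ :=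
  ℓ.continuous_of_finiteDimensional

theorem continuous_of_tensorVal (ℓ : TensorVal n s r ℝ →ₗ[ℝ] ℝ) : Continuous ℓ :=
  continuous_of_finite (V := TensorVal n s r ℝ) ℓ

/-- The `(r,s)`-tensor `u` given by a linear functional `ℓ` on `(s,r)`-tensors, i.e. with
`u · t = ℓ t` for all `t`: its value at `(β, w)` is `ℓ (w₁ ⊗ ⋯ ⊗ w_s ⊗ β¹ ⊗ ⋯ ⊗ β^r)`. -/
def ofFunctional (ℓ : TensorVal n s r ℝ →ₗ[ℝ] ℝ) : TensorVal n r s ℝ :=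
  let ℓ' : TensorVal n s r ℝ →L[ℝ] ℝ :=
    ⟨ℓ, continuous_of_tensorVal ℓ⟩
  let Φ : ContinuousMultilinearMap ℝ (fun _ : Fin r => Vec n) ℝ →ₗ[ℝ]
      ContinuousMultilinearMap ℝ (fun _ : Fin s => Vec n) ℝ :=
    { toFun := fun Q => (ℓ'.comp
        (ContinuousLinearMap.compContinuousMultilinearMapL ℝ (fun _ : Fin s => Covec n) ℝ
          (ContinuousMultilinearMap ℝ (fun _ : Fin r => Vec n) ℝ)
          ((1 : ℝ →L[ℝ] ℝ).smulRight Q))).compContinuousMultilinearMap (prodVec n s)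
      map_add' := fun Q Q' => by
        ext w
        refine (congrArg ℓ' ?_).trans (map_add _ _ _)
        ext α u
        exact smul_add (prodVec n s w α) (Q u) (Q' u)
      map_smul' := fun c Q => by
        ext w
        refine (congrArg ℓ' ?_).trans (map_smul _ _ _)
        ext α u
        exact smul_comm (prodVec n s w α) c (Q u) }
  (LinearMap.toContinuousLinearMap Φ).compContinuousMultilinearMap (prodForm (Vec n) r)

theorem ofFunctional_apply (ℓ : TensorVal n s r ℝ →ₗ[ℝ] ℝ) (β : Fin r → Covec n)
    (w : Fin s → Vec n) : ofFunctional ℓ β w = ℓ (decomp w β) := by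
  rfl

/-- A vector bundle over `X` presented by vector bundle charts. The fibres are identified with `F`
as sets, so that sections are maps `X → F`; the `i`-th vector bundle chart has base chart `chart i`
and sends `a` in the fibre over `(chart i).symm x` to `(x, triv i x a)`. -/
structure VBAtlas (X Z F : Type*) [TopologicalSpace X] [NormedAddCommGroup Z] [NormedSpace ℝ Z]
    [NormedAddCommGroup F] [NormedSpace ℝ F] where
  ι : Type*
  chart : ι → OpenPartialHomeomorph X Z
  triv : ι → Z → F →L[ℝ] F

namespace VBAtlas

variable {X Y Z F : Type*} [TopologicalSpace X] [TopologicalSpace Y]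
  [NormedAddCommGroup Z] [NormedSpace ℝ Z]
  [NormedAddCommGroup F] [NormedSpace ℝ F] (𝒜 : VBAtlas X Z F) (ℬ : VBAtlas Y Z F)

/-- The local representative of the section `φ` in the `i`-th vector bundle chart. -/
def rep (i : 𝒜.ι) (φ : X → F) (x : Z) : F := 𝒜.triv i x (φ ((𝒜.chart i).symm x))

/-- Smooth sections. -/
def IsSmooth (φ : X → F) : Prop := ∀ i, ContDiffOn ℝ ∞ (𝒜.rep i φ) (𝒜.chart i).target

/-- The space `Γ` of smooth sections. -/
def sections : Submodule ℝ (X → F) where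
  carrier := {φ | 𝒜.IsSmooth φ}
  add_mem' {a b} ha hb i := ((ha i).add (hb i)).congr fun x _ => by simp [rep]
  zero_mem' i := contDiffOn_const (c := 0) |>.congr fun x _ => by simp [rep]
  smul_mem' c a ha i := ((ha i).const_smul c).congr fun x _ => by simp [rep]

/-- The space `Γ_c` of smooth sections with compact support. -/
def compactSections : Submodule ℝ (X → F) where
  carrier := {φ | 𝒜.IsSmooth φ ∧ HasCompactSupport φ}
  add_mem' ha hb := ⟨𝒜.sections.add_mem ha.1 hb.1, ha.2.add hb.2⟩
  zero_mem' := ⟨𝒜.sections.zero_mem, HasCompactSupport.zero⟩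
  smul_mem' c _ ha := ⟨𝒜.sections.smul_mem c ha.1, ha.2.smul_left (f := fun _ => c)⟩

/-- For a seminorm `P` on `Γ_c` (or `P = |v|` with `v` linear): continuity for the (LF)-topology, the
locally convex inductive limit of the spaces `Γ_{c,K}`. On each `Γ_{c,K}`, `P` is dominated by finitely
many of the seminorms that take suprema of derivatives of local representatives, of order at most `k`,
over compact sets `L j` in chart targets (`B` is any upper bound of these suprema). -/
def IsLFContinuous (P : 𝒜.compactSections → ℝ) : Prop :=
  ∀ K : Set X, IsCompact K →
    ∃ (m k : ℕ) (i : Fin m → 𝒜.ι) (L : Fin m → Set Z) (C : ℝ),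
      (∀ j, IsCompact (L j) ∧ L j ⊆ (𝒜.chart (i j)).target) ∧
      ∀ φ : 𝒜.compactSections, tsupport φ.1 ⊆ K → ∀ B : ℝ, 0 ≤ B →
        (∀ j, ∀ x ∈ L j, ∀ l ≤ k, ‖iteratedFDeriv ℝ l (𝒜.rep (i j) φ.1) x‖ ≤ B) → P φ ≤ C * B

/-- Convergence in `Γ_c` for the (LF)-topology: with respect to all its continuous seminorms. -/
def LFTendsto {T : Type*} (f : T → 𝒜.compactSections) (l : Filter T) (φ : 𝒜.compactSections) : Prop :=
  ∀ P : Seminorm ℝ 𝒜.compactSections, 𝒜.IsLFContinuous P → Filter.Tendsto (fun h => P (f h - φ)) l (𝓝 0)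

/-- Smooth curves `ℝ → Γ_c` for the (LF)-topology: curves having derivatives `d k` of all orders `k`. -/
def IsSmoothCurve (c : ℝ → 𝒜.compactSections) : Prop :=
  ∃ d : ℕ → ℝ → 𝒜.compactSections, d 0 = c ∧ ∀ k t,
    𝒜.LFTendsto (fun h : ℝ => h⁻¹ • (d k (t + h) - d k t)) (𝓝[≠] 0) (d (k + 1) t)

/-- An isomorphism of vector bundles covering the homeomorphism `base`, presented by its pull-back
`toFun` of sections, which up to a locally constant sign carries the vector bundle charts of `𝒜` into
vector bundle charts of `ℬ`. -/
structure Iso where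
  base : X ≃ₜ Y
  toFun : (Y → F) →ₗ[ℝ] (X → F)
  index : 𝒜.ι → ℬ.ι
  target_eq : ∀ i, (ℬ.chart (index i)).target = (𝒜.chart i).target
  supp : ∀ φ p, φ (base p) = 0 → toFun φ p = 0
  rep_eq : ∀ i, ∀ x ∈ (𝒜.chart i).target, ∃ σ : ℝ, |σ| = 1 ∧
    ∀ᶠ y in 𝓝 x, ∀ φ, 𝒜.rep i (toFun φ) y = σ • ℬ.rep (index i) φ y

variable {𝒜 ℬ}

theorem Iso.tsupport_subset (T : Iso 𝒜 ℬ) (φ : Y → F) :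
    tsupport (T.toFun φ) ⊆ T.base ⁻¹' tsupport φ := by
  refine closure_minimal (fun p hp => subset_tsupport _ fun h => hp (T.supp _ _ h)) ?_
  exact (isClosed_tsupport φ).preimage T.base.continuous

/-- The pull-back of compactly supported smooth sections. -/
def Iso.pull (T : Iso 𝒜 ℬ) : ℬ.compactSections →ₗ[ℝ] 𝒜.compactSections :=
  T.toFun.restrict (p := ℬ.compactSections) (q := 𝒜.compactSections) <| by
    rintro φ ⟨hs, hc⟩
    refine ⟨fun i x hx => ?_, ?_⟩
    · obtain ⟨σ, -, h⟩ := T.rep_eq i x hx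
      have h2 := ((hs (T.index i)).contDiffAt (x := x)
        ((ℬ.chart _).open_target.mem_nhds (by rwa [T.target_eq]))).const_smul σ
      exact (h2.congr_of_eventuallyEq (h.mono fun y hy => hy φ)).contDiffWithinAt
    · exact IsCompact.of_isClosed_subset (T.base.isCompact_preimage.2 hc)
        (isClosed_tsupport _) (T.tsupport_subset φ)

theorem Iso.norm_iteratedFDeriv (T : Iso 𝒜 ℬ) (φ : Y → F) (i : 𝒜.ι) (x : Z)
    (hx : x ∈ (𝒜.chart i).target) (l : ℕ) (hφ : ℬ.IsSmooth φ) :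
    ‖iteratedFDeriv ℝ l (𝒜.rep i (T.toFun φ)) x‖ =
      ‖iteratedFDeriv ℝ l (ℬ.rep (T.index i) φ) x‖ := by
  obtain ⟨σ, hσ, h⟩ := T.rep_eq i x hx
  have : 𝒜.rep i (T.toFun φ) =ᶠ[𝓝 x] σ • ℬ.rep (T.index i) φ := h.mono fun y hy => hy φ
  rw [(this.iteratedFDeriv ℝ l).self_of_nhds, iteratedFDeriv_const_smul_apply, norm_smul,
    Real.norm_eq_abs, hσ, one_mul]
  exact ((hφ (T.index i)).contDiffAt
    ((ℬ.chart _).open_target.mem_nhds (by rwa [T.target_eq]))).of_le (by exact_mod_cast le_top)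

theorem Iso.isLFContinuous (T : Iso 𝒜 ℬ) (P : 𝒜.compactSections → ℝ) (hP : 𝒜.IsLFContinuous P) :
    ℬ.IsLFContinuous (fun φ => P (T.pull φ)) := by
  intro K hK
  obtain ⟨m, k, i, L, C, hL, h⟩ := hP (T.base ⁻¹' K) (T.base.isCompact_preimage.2 hK)
  refine ⟨m, k, fun j => T.index (i j), L, C, fun j => ⟨(hL j).1, ?_⟩, fun φ hφ B hB hb => ?_⟩
  · rw [T.target_eq]; exact (hL j).2
  · refine h _ ((T.tsupport_subset φ.1).trans (Set.preimage_mono hφ)) B hB fun j x hx l hl => ?_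
    exact (T.norm_iteratedFDeriv φ.1 (i j) x ((hL j).2 hx) l φ.2.1).trans_le (hb j x hx l hl)

end VBAtlas

/-- A natural way for tangent isomorphisms to act on a fibre `F`: `act L L'` is the pull-back along
`L : V → W`, where `L'` plays the role of `L⁻¹`. -/
structure NaturalFibre (n : ℕ) (F : Type) [NormedAddCommGroup F] [NormedSpace ℝ F] where
  act : (Vec n →L[ℝ] Vec n) → (Vec n →L[ℝ] Vec n) → F →L[ℝ] F
  act_act : ∀ L₁ L₁' L₂ L₂' f, act L₁ L₁' (act L₂ L₂' f) = act (L₂.comp L₁) (L₁'.comp L₂') f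

/-- The fibre of `Λⁿ T^*M`. -/
def formFib (n : ℕ) : NaturalFibre n (Form n) where
  act L _ := formAct L
  act_act _ _ _ _ _ := rfl

/-- The fibre of `T^r_s M`. -/
def tensorFib (n r s : ℕ) : NaturalFibre n (TensorVal n r s ℝ) where
  act := tensorAct
  act_act _ _ _ _ _ := rfl

/-- The fibre of the bundle `T^r_s M ⊗ Λⁿ T^*M` of `(r,s)`-tensor densities. -/
def densFib (n r s : ℕ) : NaturalFibre n (TensorVal n r s (Form n)) where
  act L L' := (tensorPost (formAct L)).comp (tensorAct L L')
  act_act _ _ _ _ _ := rfl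

section Manifold

variable (n : ℕ) (M : Type*) [TopologicalSpace M] [ChartedSpace (Vec n) M]

/-- The charts of `M`: all members of its maximal smooth atlas. -/
abbrev Chart : Type _ := {e : OpenPartialHomeomorph M (Vec n) //
  e ∈ IsManifold.maximalAtlas (𝓡 n) ∞ M}

variable {n}

/-- The natural bundle over `M` with the given fibre, with the vector bundle charts induced by the
charts `e` of `M`, i.e. pull-back along `e⁻¹`. -/
def NaturalFibre.atlas {F : Type} [NormedAddCommGroup F] [NormedSpace ℝ F] (N : NaturalFibre n F) :
    VBAtlas M (Vec n) F where
  ι := Chart n M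
  chart e := e.1
  triv e x := N.act (der e.1.symm x) (der e.1 (e.1.symm x))

variable (n)

/-- The bundle `TO(M,M)` over `M × M` with fibre `L(T_pM, T_qM)` over `(p,q)`; the vector bundle chart
of a pair of charts is `A ↦ T_q e₂ ∘ A ∘ T_x (e₁⁻¹)`. -/
def transportAtlas : VBAtlas (M × M) (Vec n × Vec n) (Vec n →L[ℝ] Vec n) where
  ι := Chart n M × Chart n M
  chart e := e.1.1.prod e.2.1
  triv e z := (ContinuousLinearMap.compL ℝ (Vec n) (Vec n) (Vec n)
      (der e.2.1 (e.2.1.symm z.2))).comp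
    ((ContinuousLinearMap.compL ℝ (Vec n) (Vec n) (Vec n)).flip (der e.1.1.symm z.1))

/-- The space `Ω^n_c(M)`. -/
abbrev CForms := ((formFib n).atlas M).compactSections
/-- The space `Γ_c(T^s_r M ⊗ Λⁿ T^*M) = T^s_r(M) ⊗_{C^∞(M)} Ω^n_c(M)` of compactly supported
`(s,r)`-tensor densities. -/
abbrev CDens (s r : ℕ) := ((densFib n s r).atlas M).compactSections
/-- The space of compactly supported transport operators on `M`; `A (p, q) : T_pM → T_qM`. -/
abbrev CTransport := (transportAtlas n M).compactSections

/-- An orientation of `M`, given by a nowhere vanishing smooth `n`-form (only its sign on frames is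
used below). -/
structure OrientationForm where
  form : M → Form n
  smooth : ((formFib n).atlas M).IsSmooth form
  ne_zero : ∀ p, form p ≠ 0

/-- The standard frame of `ℝⁿ`. -/
def stdFrame : Fin n → Vec n := fun i => EuclideanSpace.single i 1

variable {n M}

theorem Chart.mdiff [IsManifold (𝓡 n) ∞ M] (e : Chart n M) {p : M} (hp : p ∈ e.1.source) :
    MDifferentiableAt (𝓡 n) (𝓡 n) e.1 p :=
  (contMDiffAt_of_mem_maximalAtlas e.2 hp).mdifferentiableAt (by simp)

theorem Chart.mdiff_symm [IsManifold (𝓡 n) ∞ M] (e : Chart n M) {x : Vec n} (hx : x ∈ e.1.target) :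
    MDifferentiableAt (𝓡 n) (𝓡 n) e.1.symm x :=
  (contMDiffAt_symm_of_mem_maximalAtlas e.2 hx).mdifferentiableAt (by simp)

theorem der_congr {X Y : Type*} [TopologicalSpace X] [ChartedSpace (Vec n) X] [TopologicalSpace Y]
    [ChartedSpace (Vec n) Y] {f g : X → Y} {p : X} (h : f =ᶠ[𝓝 p] g) :
    der (n := n) f p = der g p := by
  unfold der
  exact h.mfderiv_eq

theorem Chart.der_symm_comp [IsManifold (𝓡 n) ∞ M] (e : Chart n M) {p : M} (hp : p ∈ e.1.source) :
    (der e.1.symm (e.1 p)).comp (der e.1 p) = ContinuousLinearMap.id ℝ (Vec n) := by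
  rw [← der_comp _ _ _ (e.mdiff_symm (e.1.map_source hp)) (e.mdiff hp), ← der_id p]
  apply der_congr
  filter_upwards [e.1.open_source.mem_nhds hp] with q hq
  exact e.1.left_inv hq

theorem Chart.der_comp_symm [IsManifold (𝓡 n) ∞ M] (e : Chart n M) {x : Vec n}
    (hx : x ∈ e.1.target) :
    (der e.1 (e.1.symm x)).comp (der e.1.symm x) = ContinuousLinearMap.id ℝ (Vec n) := by
  rw [← der_comp _ _ _ (e.mdiff (e.1.map_target hx)) (e.mdiff_symm hx), ← der_id x]
  apply der_congr
  filter_upwards [e.1.open_target.mem_nhds hx] with q hq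
  exact e.1.right_inv hq

theorem form_ext_frame {η : Form n} (h : η (stdFrame n) = 0) : η = 0 := by
  let b := (EuclideanSpace.basisFun (Fin n) ℝ).toBasis
  have hb : (⇑b : Fin n → Vec n) = stdFrame n := by
    ext i; simp [b, stdFrame]
  have h1 := AlternatingMap.eq_smul_basis_det b η.toAlternatingMap
  rw [hb] at h1
  have h2 : η.toAlternatingMap (stdFrame n) = 0 := h
  rw [h2, zero_smul] at h1
  ext v
  exact congrArg (fun f => f v) h1

theorem form_comp_frame (η : Form n) (L : Vec n →L[ℝ] Vec n) :
    formAct L η (stdFrame n) = L.det * η (stdFrame n) := by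
  let b := (EuclideanSpace.basisFun (Fin n) ℝ).toBasis
  have hb : (⇑b : Fin n → Vec n) = stdFrame n := by
    ext i; simp [b, stdFrame]
  have h1 := AlternatingMap.eq_smul_basis_det b η.toAlternatingMap
  rw [hb] at h1
  have h3 : η (fun i => L (stdFrame n i)) = η (stdFrame n) * b.det (fun i => L (stdFrame n i)) :=
    congrArg (fun f => f (fun i => L (stdFrame n i))) h1
  have h4 := b.det_comp (L : Vec n →ₗ[ℝ] Vec n) b
  rw [b.det_self, mul_one, hb] at h4
  change η (fun i => L (stdFrame n i)) = _
  rw [h3, mul_comm]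
  congr 1

theorem OrientationForm.rep_ne_zero [IsManifold (𝓡 n) ∞ M] (τ : OrientationForm n M)
    (e : Chart n M) {x : Vec n} (hx : x ∈ e.1.target) :
    ((formFib n).atlas M).rep e τ.form x (stdFrame n) ≠ 0 := by
  intro h
  have h1 := form_ext_frame h
  apply τ.ne_zero (e.1.symm x)
  have h2 : formAct (der e.1 (e.1.symm x)) (((formFib n).atlas M).rep e τ.form x) = 0 := by
    rw [h1, map_zero]
  have h3 := e.der_symm_comp (e.1.map_target hx)
  rw [e.1.right_inv hx] at h3
  have h4 : formAct ((der e.1.symm x).comp (der e.1 (e.1.symm x))) (τ.form (e.1.symm x)) = 0 := h2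
  rw [h3] at h4
  exact h4

/-- The spreading `q ↦ A^s_r(p,q) t` of an `(s,r)`-tensor `t` at `p` via `A`, where `A^s_r(p,q)` maps
`w₁ ⊗ ⋯ ⊗ β^r` to `A(p,q) w₁ ⊗ ⋯ ⊗ A(q,p)^ad β^r`. -/
def spread {s r : ℕ} (A : CTransport n M) (p : M) (t : TensorVal n s r ℝ) (q : M) :
    TensorVal n s r ℝ :=
  tensorAct (A.1 (q, p)) (A.1 (p, q)) t

section Generic

variable {H V W G G' : Type} [NormedAddCommGroup H] [NormedSpace ℝ H]
  [NormedAddCommGroup V] [NormedSpace ℝ V] [NormedAddCommGroup W] [NormedSpace ℝ W]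
  [NormedAddCommGroup G] [NormedSpace ℝ G] [NormedAddCommGroup G'] [NormedSpace ℝ G']
  {k : ℕ} {S : Set H}

theorem contDiffOn_clm (X Y : Type) [NormedAddCommGroup X] [NormedSpace ℝ X]
    [NormedAddCommGroup Y] [NormedSpace ℝ Y] (f : X →L[ℝ] Y) {g : H → X}
    (hg : ContDiffOn ℝ ∞ g S) : ContDiffOn ℝ ∞ (fun h => f (g h)) S :=
  f.contDiff.comp_contDiffOn hg

theorem contDiffOn_precomp {L : H → V →L[ℝ] W}
    {t : H → ContinuousMultilinearMap ℝ (fun _ : Fin k => W) G}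
    (hL : ContDiffOn ℝ ∞ L S) (ht : ContDiffOn ℝ ∞ t S) :
    ContDiffOn ℝ ∞ (fun h => (t h).compContinuousLinearMap (fun _ => L h)) S := by
  have := (ContinuousMultilinearMap.contDiff (n := ∞)
    (ContinuousMultilinearMap.compContinuousLinearMapContinuousMultilinear ℝ
      (fun _ : Fin k => V) (fun _ : Fin k => W) G)).comp_contDiffOn
      (contDiffOn_pi.2 fun _ : Fin k => hL)
  exact this.clm_apply ht

theorem contDiffOn_precompL {L : H → V →L[ℝ] W} (hL : ContDiffOn ℝ ∞ L S) :
    ContDiffOn ℝ ∞ (fun h => ContinuousMultilinearMap.compContinuousLinearMapL (F := G)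
      (fun _ : Fin k => L h)) S :=
  (ContinuousMultilinearMap.contDiff (n := ∞)
    (ContinuousMultilinearMap.compContinuousLinearMapContinuousMultilinear ℝ
      (fun _ : Fin k => V) (fun _ : Fin k => W) G)).comp_contDiffOn
      (contDiffOn_pi.2 fun _ : Fin k => hL)

theorem contDiffOn_postcompL {g : H → G →L[ℝ] G'} (hg : ContDiffOn ℝ ∞ g S) :
    ContDiffOn ℝ ∞ (fun h => ContinuousLinearMap.compContinuousMultilinearMapL ℝ
    (fun _ : Fin k => V) G G' (g h)) S :=
  contDiffOn_clm (G →L[ℝ] G') (ContinuousMultilinearMap ℝ (fun _ : Fin k => V) G →L[ℝ]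
    ContinuousMultilinearMap ℝ (fun _ : Fin k => V) G')
    (ContinuousLinearMap.compContinuousMultilinearMapL ℝ (fun _ : Fin k => V) G G') hg

theorem contDiffOn_postcomp {g : H → G →L[ℝ] G'}
    {t : H → ContinuousMultilinearMap ℝ (fun _ : Fin k => V) G}
    (hg : ContDiffOn ℝ ∞ g S) (ht : ContDiffOn ℝ ∞ t S) :
    ContDiffOn ℝ ∞ (fun h => (g h).compContinuousMultilinearMap (t h)) S :=
  (contDiffOn_postcompL hg).clm_apply ht

theorem contDiffOn_tensorAct {r s n : ℕ} {L L' : H → Vec n →L[ℝ] Vec n}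
    {t : H → TensorVal n r s G} (hL : ContDiffOn ℝ ∞ L S) (hL' : ContDiffOn ℝ ∞ L' S)
    (ht : ContDiffOn ℝ ∞ t S) : ContDiffOn ℝ ∞ (fun h => tensorAct (L h) (L' h) (t h)) S :=
  contDiffOn_postcomp (contDiffOn_precompL hL) (contDiffOn_precomp
    (contDiffOn_clm (Vec n →L[ℝ] Vec n) (Covec n →L[ℝ] Covec n)
      (ContinuousLinearMap.compL ℝ (Vec n) (Vec n) ℝ).flip hL') ht)

theorem contDiffOn_tensorPost {r s n : ℕ} {g : H → G →L[ℝ] G'} {t : H → TensorVal n r s G}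
    (hg : ContDiffOn ℝ ∞ g S) (ht : ContDiffOn ℝ ∞ t S) :
    ContDiffOn ℝ ∞ (fun h => tensorPost (g h) (t h)) S :=
  contDiffOn_postcomp (contDiffOn_postcompL hg) ht

end Generic

theorem spread_smooth [IsManifold (𝓡 n) ∞ M] {s r : ℕ} (A : CTransport n M) (p : M)
    (t : TensorVal n s r ℝ) (η : CForms n M) : ((densFib n s r).atlas M).IsSmooth
    (fun q => tensorPost ((1 : ℝ →L[ℝ] ℝ).smulRight (η.1 q)) (spread A p t q)) := by
  intro e
  let e' : Chart n M := ⟨chartAt (Vec n) p, IsManifold.chart_mem_maximalAtlas p⟩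
  have hp : p ∈ e'.1.source := mem_chart_source _ p
  have hy := e'.1.map_source hp
  have hA1 : ContDiffOn ℝ ∞ (fun x => (transportAtlas n M).rep (e, e') A.1 (x, e'.1 p))
      e.1.target :=
    (A.2.1 (e, e')).comp (contDiff_id.prodMk contDiff_const).contDiffOn
      fun x hx => ⟨hx, hy⟩
  have hA2 : ContDiffOn ℝ ∞ (fun x => (transportAtlas n M).rep (e', e) A.1 (e'.1 p, x))
      e.1.target :=
    (A.2.1 (e', e)).comp (contDiff_const.prodMk contDiff_id).contDiffOn
      fun x hx => ⟨hy, hx⟩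
  have hB1 := (contDiffOn_const (c := der e'.1.symm (e'.1 p)) (𝕜 := ℝ) (n := ∞)
    (s := e.1.target)).clm_comp hA1
  have hB2 := hA2.clm_comp (contDiffOn_const (c := der e'.1 p) (𝕜 := ℝ) (n := ∞)
    (s := e.1.target))
  have hS : ContDiffOn ℝ ∞ (fun x => (1 : ℝ →L[ℝ] ℝ).smulRight
      (((formFib n).atlas M).rep e η.1 x)) e.1.target :=
    contDiffOn_clm (Form n) (ℝ →L[ℝ] Form n) (ContinuousLinearMap.smulRightL ℝ ℝ (Form n) 1)
      (η.2.1 e)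
  refine (contDiffOn_tensorPost hS (contDiffOn_tensorAct hB1 hB2
    (contDiffOn_const (c := t)))).congr fun x hx => ?_
  have k1 : (der e'.1.symm (e'.1 p)).comp
      ((transportAtlas n M).rep (e, e') A.1 (x, e'.1 p)) =
      (A.1 (e.1.symm x, p)).comp (der e.1.symm x) := by
    have : (transportAtlas n M).rep (e, e') A.1 (x, e'.1 p) =
      (der e'.1 p).comp ((A.1 (e.1.symm x, p)).comp (der e.1.symm x)) := by
      change (der e'.1 (e'.1.symm (e'.1 p))).comp
        ((A.1 (e.1.symm x, e'.1.symm (e'.1 p))).comp (der e.1.symm x)) = _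
      rw [e'.1.left_inv hp]
    rw [this, ← ContinuousLinearMap.comp_assoc, e'.der_symm_comp hp,
      ContinuousLinearMap.id_comp]
  have k2 : ((transportAtlas n M).rep (e', e) A.1 (e'.1 p, x)).comp (der e'.1 p) =
      (der e.1 (e.1.symm x)).comp (A.1 (p, e.1.symm x)) := by
    have : (transportAtlas n M).rep (e', e) A.1 (e'.1 p, x) =
      (der e.1 (e.1.symm x)).comp ((A.1 (p, e.1.symm x)).comp (der e'.1.symm (e'.1 p))) := by
      change (der e.1 (e.1.symm x)).comp
        ((A.1 (e'.1.symm (e'.1 p), e.1.symm x)).comp (der e'.1.symm (e'.1 p))) = _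
      rw [e'.1.left_inv hp]
    rw [this, ContinuousLinearMap.comp_assoc, ContinuousLinearMap.comp_assoc, e'.der_symm_comp hp,
      ContinuousLinearMap.comp_id]
  rw [k1, k2]
  rfl
end Manifold
section Manifold

variable {n : ℕ} {M N : Type*} [TopologicalSpace M] [ChartedSpace (Vec n) M]
  [TopologicalSpace N] [ChartedSpace (Vec n) N]

/-- The tensor density `q ↦ (A^s_r(p,q) t) ⊗ η(q)`, linear in `t`. -/
def spreadDens [IsManifold (𝓡 n) ∞ M] {s r : ℕ} (η : CForms n M) (A : CTransport n M) (p : M) :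
    TensorVal n s r ℝ →ₗ[ℝ] CDens n M s r where
  toFun t := ⟨fun q => tensorPost ((1 : ℝ →L[ℝ] ℝ).smulRight (η.1 q)) (spread A p t q),
    spread_smooth A p t η, η.2.2.mono fun q hq hη => hq <| by
      ext α u v
      change (spread A p t q α u) • (η.1 q v) = 0
      rw [hη]; exact smul_zero _⟩
  map_add' t t' := by
    ext q α u v
    exact add_smul (spread A p t q α u) (spread A p t' q α u) (η.1 q v)
  map_smul' c t := by
    ext q α u v
    exact mul_assoc c (spread A p t q α u) (η.1 q v)

variable (n M) in
/-- Distributional `(r,s)`-tensor fields: continuous linear functionals on `(s,r)`-tensor densities. -/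
structure TensorDistribution (r s : ℕ) where
  toFun : CDens n M s r →ₗ[ℝ] ℝ
  continuous : VBAtlas.IsLFContinuous _ (fun φ => |toFun φ|)

/-- `∫_M η = c`, the manifold being oriented by `τ`: `η` is a finite sum of forms `ζ j`, each supported
in the domain of a chart, whose Lebesgue integrals in these charts add up to `c`. The sign of `τ` on the
coordinate frame accounts for charts that are not positively oriented. -/
def HasIntegral (τ : OrientationForm n M) (η : CForms n M) (c : ℝ) : Prop :=
  ∃ (m : ℕ) (e : Fin m → Chart n M) (ζ : Fin m → CForms n M),
    (∀ j, tsupport (ζ j).1 ⊆ (e j).1.source) ∧ η = ∑ j, ζ j ∧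
    c = ∑ j, ∫ x in (e j).1.target,
      Real.sign (((formFib n).atlas M).rep (e j) τ.form x (stdFrame n)) *
        ((formFib n).atlas M).rep (e j) (ζ j).1 x (stdFrame n)

/-- The space `Â₀(M)` of compactly supported `n`-forms with integral `1`. -/
abbrev UnitForm (τ : OrientationForm n M) : Type _ := {η : CForms n M // HasIntegral τ η 1}

/-- Maps assigning an `(r,s)`-tensor at `p` to each `(η, p, A) ∈ Â₀(M) × M × Γ_c(TO(M,M))`. -/
abbrev GenField (τ : OrientationForm n M) (r s : ℕ) : Type _ :=
  UnitForm τ → M → CTransport n M → TensorVal n r s ℝ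

/-- Membership in the basic space `Ê^r_s(M)`: `u` is smooth in the sense of convenient calculus, i.e.
it maps smooth curves in `Â₀(M) × M × Γ_c(TO(M,M))` to smooth curves in the bundle `T^r_s M` (smooth in
each vector bundle chart). -/
def IsBasic (τ : OrientationForm n M) (r s : ℕ) (u : GenField τ r s) : Prop :=
  ∀ (η : ℝ → UnitForm τ) (p : ℝ → M) (A : ℝ → CTransport n M),
    ((formFib n).atlas M).IsSmoothCurve (fun t => (η t).1) →
    ContMDiff 𝓘(ℝ, ℝ) (𝓡 n) ∞ p → (transportAtlas n M).IsSmoothCurve A →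
    ∀ e : Chart n M, ContDiffOn ℝ ∞
      (fun t => ((tensorFib n r s).atlas M).triv e (e.1 (p t)) (u (η t) (p t) (A t)))
      {t | p t ∈ e.1.source}

/-- The embedding `ι^r_s`: `ι(v)(η,p,A) · t = ⟨v, (A^s_r(p,·) t) ⊗ η⟩` for all `(s,r)`-tensors `t` at `p`. -/
def iota [IsManifold (𝓡 n) ∞ M] (τ : OrientationForm n M) {r s : ℕ}
    (v : TensorDistribution n M r s) : GenField τ r s :=
  fun η p A => ofFunctional (v.toFun ∘ₗ spreadDens η.1 A p)

variable [IsManifold (𝓡 n) ∞ M] [IsManifold (𝓡 n) ∞ N] (μ : M ≃ₘ⟮𝓡 n, 𝓡 n⟯ N)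

theorem mdiff_diffeo (p : M) : MDifferentiableAt (𝓡 n) (𝓡 n) μ p :=
  μ.contMDiff.contMDiffAt.mdifferentiableAt (by simp)

/-- The chart `e ∘ μ⁻¹` of `N`. -/
def chartPull (e : Chart n M) : Chart n N :=
  ⟨μ.symm.toHomeomorph.transOpenPartialHomeomorph e.1, by
    refine OpenPartialHomeomorph.mem_maximalAtlas_of_contMDiffOn _ ?_ ?_
    · exact (contMDiffOn_of_mem_maximalAtlas e.2).comp μ.symm.contMDiff.contMDiffOn
        fun q hq => hq
    · exact μ.contMDiff.comp_contMDiffOn (contMDiffOn_symm_of_mem_maximalAtlas e.2)⟩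

theorem der_chartPull_symm (e : Chart n M) {x : Vec n} (hx : x ∈ e.1.target) :
    der (n := n) (chartPull μ e).1.symm x = (der μ (e.1.symm x)).comp (der e.1.symm x) :=
  der_comp μ e.1.symm x (mdiff_diffeo μ _) (e.mdiff_symm hx)

theorem der_chartPull (e : Chart n M) {p : M} (hp : p ∈ e.1.source) :
    der (n := n) (chartPull μ e).1 (μ p) = (der e.1 p).comp (der μ.symm (μ p)) := by
  have h := der_comp (n := n) e.1 μ.symm (μ p) (by rw [μ.symm_apply_apply]; exact e.mdiff hp)
    (mdiff_diffeo μ.symm _)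
  rwa [μ.symm_apply_apply] at h

/-- The sign `±1` telling whether `T_pμ` preserves or reverses the orientations. -/
def sgn (τM : OrientationForm n M) (τN : OrientationForm n N) (p : M) : ℝ :=
  Real.sign (τM.form p (stdFrame n) * formAct (der μ p) (τN.form (μ p)) (stdFrame n))

theorem sign_sq_mul {d a : ℝ} (hd : d ≠ 0) : Real.sign (d * d * a) = Real.sign a := by
  have h : 0 < d * d := mul_self_pos.2 hd
  rcases lt_trichotomy a 0 with ha | ha | ha
  · rw [Real.sign_of_neg ha, Real.sign_of_neg (mul_neg_of_pos_of_neg h ha)]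
  · simp [ha]
  · rw [Real.sign_of_pos ha, Real.sign_of_pos (mul_pos h ha)]

theorem sgn_eq (τM : OrientationForm n M) (τN : OrientationForm n N) (e : Chart n M) {x : Vec n}
    (hx : x ∈ e.1.target) : sgn μ τM τN (e.1.symm x) =
      Real.sign (((formFib n).atlas M).rep e τM.form x (stdFrame n) *
        ((formFib n).atlas N).rep (chartPull μ e) τN.form x (stdFrame n)) := by
  have h1 : ((formFib n).atlas M).rep e τM.form x (stdFrame n) =
      (der (n := n) e.1.symm x).det * τM.form (e.1.symm x) (stdFrame n) := form_comp_frame _ _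
  have h2 : ((formFib n).atlas N).rep (chartPull μ e) τN.form x (stdFrame n) =
      (der (n := n) e.1.symm x).det *
        formAct (n := n) (der μ (e.1.symm x)) (τN.form (μ (e.1.symm x))) (stdFrame n) := by
    rw [← form_comp_frame]
    change formAct (der (n := n) (chartPull μ e).1.symm x) (τN.form (μ (e.1.symm x))) _ = _
    rw [der_chartPull_symm μ e hx]
    rfl
  have hd : (der (n := n) e.1.symm x).det ≠ 0 := by
    intro h
    apply τM.rep_ne_zero e hx
    rw [h1, h, zero_mul]
  rw [h1, h2, mul_mul_mul_comm, sign_sq_mul hd]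
  rfl

theorem frame_continuousOn (τM : OrientationForm n M) (e : Chart n M) :
    ContinuousOn (fun x => ((formFib n).atlas M).rep e τM.form x (stdFrame n)) e.1.target :=
  (ContinuousAlternatingMap.apply ℝ (Vec n) ℝ (stdFrame n)).continuous.comp_continuousOn
    (τM.smooth e).continuousOn

theorem sgn_locally_const (τM : OrientationForm n M) (τN : OrientationForm n N) (e : Chart n M)
    {x : Vec n} (hx : x ∈ e.1.target) : |sgn μ τM τN (e.1.symm x)| = 1 ∧
      ∀ᶠ y in 𝓝 x, sgn μ τM τN (e.1.symm y) = sgn μ τM τN (e.1.symm x) := by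
  set g : Vec n → ℝ := fun x => ((formFib n).atlas M).rep e τM.form x (stdFrame n) *
        ((formFib n).atlas N).rep (chartPull μ e) τN.form x (stdFrame n) with hg
  have hc : ContinuousAt g x := ((frame_continuousOn τM e).mul
    (frame_continuousOn τN (chartPull μ e))).continuousAt (e.1.open_target.mem_nhds hx)
  have h0 : g x ≠ 0 := mul_ne_zero (τM.rep_ne_zero e hx) (τN.rep_ne_zero (chartPull μ e) hx)
  have hs : ∀ y ∈ e.1.target, sgn μ τM τN (e.1.symm y) = Real.sign (g y) :=
    fun y hy => sgn_eq μ τM τN e hy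
  have ht := e.1.open_target.mem_nhds hx
  rw [hs x hx]
  rcases lt_or_gt_of_ne h0 with h | h
  · rw [Real.sign_of_neg h]
    refine ⟨by simp, ?_⟩
    filter_upwards [ht, hc.eventually_lt_const h] with y hy hy'
    rw [hs y hy, Real.sign_of_neg hy']
  · rw [Real.sign_of_pos h]
    refine ⟨by simp, ?_⟩
    filter_upwards [ht, hc.eventually_const_lt h] with y hy hy'
    rw [hs y hy, Real.sign_of_pos hy']

theorem iso_rep {F : Type} [NormedAddCommGroup F] [NormedSpace ℝ F] (𝒩 : NaturalFibre n F) (σ : M → ℝ)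
    (e : Chart n M) {y : Vec n} (hy : y ∈ e.1.target) (φ : N → F) :
    (𝒩.atlas M).rep e (fun p => σ p • 𝒩.act (der μ p) (der μ.symm (μ p)) (φ (μ p))) y =
      σ (e.1.symm y) • (𝒩.atlas N).rep (chartPull μ e) φ y := by
  change 𝒩.act (der e.1.symm y) (der e.1 (e.1.symm y)) (σ (e.1.symm y) •
    𝒩.act (der μ (e.1.symm y)) (der μ.symm (μ (e.1.symm y))) (φ (μ (e.1.symm y)))) =
    σ (e.1.symm y) • 𝒩.act (der (n := n) (chartPull μ e).1.symm y)
      (der (n := n) (chartPull μ e).1 (μ (e.1.symm y))) (φ (μ (e.1.symm y)))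
  rw [map_smul, 𝒩.act_act, der_chartPull_symm μ e hy, der_chartPull μ e (e.1.map_target hy)]

theorem chartPull_chartPull_symm (e : Chart n N) : chartPull μ (chartPull μ.symm e) = e := by
  apply Subtype.ext
  refine OpenPartialHomeomorph.ext _ _ (fun q => ?_) (fun x => ?_) ?_
  · change e.1 (μ (μ.symm q)) = e.1 q
    rw [μ.apply_symm_apply]
  · change μ (μ.symm (e.1.symm x)) = e.1.symm x
    rw [μ.apply_symm_apply]
  · ext q
    change μ (μ.symm q) ∈ e.1.source ↔ q ∈ e.1.source
    rw [μ.apply_symm_apply]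

theorem sign_mul_sign {a b z : ℝ} (ha : a ≠ 0) (hb : b ≠ 0) :
    Real.sign b * z = Real.sign a * (Real.sign (a * b) * z) := by
  rcases lt_or_gt_of_ne ha with h | h <;> rcases lt_or_gt_of_ne hb with h' | h'
  · rw [Real.sign_of_neg h, Real.sign_of_neg h', Real.sign_of_pos (mul_pos_of_neg_of_neg h h')]
    ring
  · rw [Real.sign_of_neg h, Real.sign_of_pos h', Real.sign_of_neg (mul_neg_of_neg_of_pos h h')]
    ring
  · rw [Real.sign_of_pos h, Real.sign_of_neg h', Real.sign_of_neg (mul_neg_of_pos_of_neg h h')]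
    ring
  · rw [Real.sign_of_pos h, Real.sign_of_pos h', Real.sign_of_pos (mul_pos h h')]
    ring

/-- The pull-back along `μ` of sections of a natural bundle, multiplied by the sign `sgn`. It is used
for forms and tensor densities regarded as densities by means of the orientations; for orientation
preserving `μ` the sign is `1`. -/
def NaturalFibre.iso {F : Type} [NormedAddCommGroup F] [NormedSpace ℝ F] (𝒩 : NaturalFibre n F)
    (τM : OrientationForm n M) (τN : OrientationForm n N) :
    VBAtlas.Iso (𝒩.atlas M) (𝒩.atlas N) where
  base := μ.toHomeomorph
  toFun :=
    { toFun := fun φ p => sgn μ τM τN p • 𝒩.act (der μ p) (der μ.symm (μ p)) (φ (μ p))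
      map_add' := fun φ ψ => by ext p; simp
      map_smul' := fun c φ => by ext p; simp [smul_comm c] }
  index := chartPull μ
  target_eq _ := rfl
  supp φ p h := by
    change sgn μ τM τN p • 𝒩.act (der μ p) (der μ.symm (μ p)) (φ (μ p)) = 0
    rw [show φ (μ p) = 0 from h, map_zero, smul_zero]
  rep_eq e x hx := by
    obtain ⟨h1, h2⟩ := sgn_locally_const μ τM τN e hx
    refine ⟨_, h1, ?_⟩
    filter_upwards [h2, e.1.open_target.mem_nhds hx] with y hy hy' φ
    rw [← hy]
    exact iso_rep μ 𝒩 _ e hy' φ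

/-- The pull-back of transport operators: `((μ,μ)^*A)(p,q) = (T_qμ)⁻¹ ∘ A(μ p, μ q) ∘ T_pμ`. -/
def transportIso : VBAtlas.Iso (transportAtlas n M) (transportAtlas n N) where
  base := μ.toHomeomorph.prodCongr μ.toHomeomorph
  toFun :=
    { toFun := fun A z =>
        (der μ.symm (μ z.2)).comp ((A (μ z.1, μ z.2)).comp (der μ z.1))
      map_add' := fun A B => by
        ext z : 1
        simp [ContinuousLinearMap.add_comp, ContinuousLinearMap.comp_add]
      map_smul' := fun c A => by
        ext z : 1
        simp [ContinuousLinearMap.smul_comp] }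
  index e := (chartPull μ e.1, chartPull μ e.2)
  target_eq _ := rfl
  supp A z h := by
    change (der μ.symm (μ z.2)).comp ((A (μ z.1, μ z.2)).comp (der μ z.1)) = 0
    rw [show A (μ z.1, μ z.2) = 0 from h, ContinuousLinearMap.zero_comp,
      ContinuousLinearMap.comp_zero]
  rep_eq e x hx := by
    refine ⟨1, abs_one, ?_⟩
    filter_upwards [(e.1.1.prod e.2.1).open_target.mem_nhds hx] with y hy A
    rw [one_smul]
    change (der e.2.1 (e.2.1.symm y.2)).comp (((der μ.symm (μ (e.2.1.symm y.2))).comp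
      ((A (μ (e.1.1.symm y.1), μ (e.2.1.symm y.2))).comp (der μ (e.1.1.symm y.1)))).comp
        (der e.1.1.symm y.1)) = (der (n := n) (chartPull μ e.2).1 (μ (e.2.1.symm y.2))).comp
          ((A (μ (e.1.1.symm y.1), μ (e.2.1.symm y.2))).comp
            (der (n := n) (chartPull μ e.1).1.symm y.1))
    rw [der_chartPull_symm μ e.1 hy.1, der_chartPull μ e.2 (e.2.1.map_target hy.2)]
    simp only [ContinuousLinearMap.comp_assoc]

/-- Pull-back of compactly supported `n`-forms (as densities). Push-forward along `μ` is pull-back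
along `μ⁻¹`. -/
def CForms.pull (τM : OrientationForm n M) (τN : OrientationForm n N) :
    CForms n N →ₗ[ℝ] CForms n M := ((formFib n).iso μ τM τN).pull

/-- Pull-back of tensor densities. -/
def CDens.pull (τM : OrientationForm n M) (τN : OrientationForm n N) (s r : ℕ) :
    CDens n N s r →ₗ[ℝ] CDens n M s r := ((densFib n s r).iso μ τM τN).pull

/-- Pull-back of transport operators. -/
def CTransport.pull : CTransport n N →ₗ[ℝ] CTransport n M := (transportIso μ).pull

/-- Pull-back of tensor distributions: `⟨μ^*v, φ⟩ = ⟨v, μ_*φ⟩`. -/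
def TensorDistribution.pull (τM : OrientationForm n M) (τN : OrientationForm n N) {r s : ℕ}
    (v : TensorDistribution n N r s) : TensorDistribution n M r s where
  toFun := v.toFun ∘ₗ CDens.pull μ.symm τN τM s r
  continuous := VBAtlas.Iso.isLFContinuous _ _ v.continuous

theorem HasIntegral.pull (τM : OrientationForm n M) (τN : OrientationForm n N) {η : CForms n N}
    {c : ℝ} (h : HasIntegral τN η c) : HasIntegral τM (CForms.pull μ τM τN η) c := by
  obtain ⟨m, e, ζ, h1, h2, h3⟩ := h
  refine ⟨m, fun j => chartPull μ.symm (e j), fun j => CForms.pull μ τM τN (ζ j), fun j => ?_, ?_, ?_⟩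
  · exact (VBAtlas.Iso.tsupport_subset ((formFib n).iso μ τM τN) (ζ j).1).trans
      (Set.preimage_mono (h1 j))
  · rw [h2, map_sum]
  · rw [h3]
    refine Finset.sum_congr rfl fun j _ => ?_
    refine MeasureTheory.setIntegral_congr_fun (e j).1.open_target.measurableSet fun x hx => ?_
    set e' := chartPull μ.symm (e j) with he'
    have hx' : x ∈ e'.1.target := hx
    have hr : ((formFib n).atlas M).rep e' (CForms.pull μ τM τN (ζ j)).1 x =
        sgn μ τM τN (e'.1.symm x) • ((formFib n).atlas N).rep (chartPull μ e') (ζ j).1 x :=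
      iso_rep μ (formFib n) _ e' hx' _
    have h2 := τM.rep_ne_zero e' hx'
    have h3 := τN.rep_ne_zero (chartPull μ e') hx'
    have h4 := sgn_eq μ τM τN e' hx'
    have h5 : chartPull μ e' = e j := chartPull_chartPull_symm μ (e j)
    rw [h5] at hr h3 h4
    beta_reduce
    rw [hr, h4]
    exact sign_mul_sign h2 h3

/-- Pull-back of forms with integral `1`. -/
def UnitForm.pull (τM : OrientationForm n M) (τN : OrientationForm n N) (η : UnitForm τN) :
    UnitForm τM := ⟨CForms.pull μ τM τN η.1, η.2.pull μ τM τN⟩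

/-- The action `μ̂^*` of `μ` on generalized tensor fields:
`(μ̂^*u)(η,p,A) = (T_{μ p}μ⁻¹)^r_s u(μ_*η, μ p, (μ,μ)_*A)`. -/
def GenField.pull (τM : OrientationForm n M) (τN : OrientationForm n N) {r s : ℕ}
    (u : GenField τN r s) : GenField τM r s := fun η p A =>
  tensorAct (der μ p) (der μ.symm (μ p))
    (u (UnitForm.pull μ.symm τN τM η) (μ p) (CTransport.pull μ.symm A))

end Manifold
end TensorDist

end

namespace TensorDist

variable {n : ℕ}

/-! Everything rests on naturality in charts. If `e` is a chart of `M`, then `chartPull μ e`, i.e.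
`e ∘ μ⁻¹`, is a chart of `N`, and by `iso_rep` a section of a natural bundle over `N` and its
pull-back have the same local representative in this pair of charts, up to a locally constant sign.
Transport operators behave in the same way, without a sign. The (LF)-topologies and smoothness in
the tensor bundle are both defined through local representatives, so `μ` carries them over
unchanged.

For the basic spaces, a smooth curve `(η, p, A)` over `M` is pushed forward to a smooth curve over
`N` (`VBAtlas.Iso.isSmoothCurve_pull`) and `u` is applied to it. The result, read in the chart `e ∘
μ⁻¹`, is literally the expression whose smoothness is required in the chart `e` (`triv_tensorAct`).

For the embedding, both sides at `(β, w)` are values of the same functional `v`, so it suffices that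
the two tensor densities fed to it coincide; this is `spreadDens_pull`. Conjugating `A` with `Tμ`
inserts a factor `Tμ` or `Tμ⁻¹` at the point `p`, and the transported tensor `w₁ ⊗ ⋯ ⊗ β^r` carries
the inverse factor, so these cancel. What remains at the other point is the push-forward of
densities. Orientations do not interfere: forms and tensor densities are multiplied by the same sign
`sgn`, while tensors and transport operators carry none. -/

/-! ### Smooth curves of sections under bundle isomorphisms. -/

/-- The pull-back of sections along a bundle isomorphism is continuous for the (LF)-topologies, hence
preserves smooth curves. -/
theorem VBAtlas.Iso.isSmoothCurve_pull {X Y Z F : Type*} [TopologicalSpace X] [TopologicalSpace Y]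
    [NormedAddCommGroup Z] [NormedSpace ℝ Z] [NormedAddCommGroup F] [NormedSpace ℝ F]
    {𝒜 : VBAtlas X Z F} {ℬ : VBAtlas Y Z F} (T : VBAtlas.Iso 𝒜 ℬ) {c : ℝ → ℬ.compactSections}
    (hc : ℬ.IsSmoothCurve c) : 𝒜.IsSmoothCurve (fun t => T.pull (c t)) := by
  obtain ⟨d, rfl, hd⟩ := hc
  refine ⟨fun k t => T.pull (d k t), rfl, fun k t P hP => ?_⟩
  -- Convergence is tested on continuous seminorms `P` of the target; `P ∘ T.pull` is a continuous
  -- seminorm of the source, where the limit is known. Linearity of `T.pull` then identifies the two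
  -- difference quotients.
  refine (hd k t (P.comp T.pull) (T.isLFContinuous P hP)).congr fun h => ?_
  simp only [Seminorm.comp_apply, map_sub, map_smul]

section Manifold

variable {M N : Type*} [TopologicalSpace M] [ChartedSpace (Vec n) M] [TopologicalSpace N]
  [ChartedSpace (Vec n) N] [IsManifold (𝓡 n) ∞ M] [IsManifold (𝓡 n) ∞ N] (μ : M ≃ₘ⟮𝓡 n, 𝓡 n⟯ N)

/-! ### Pull-back of tensors in charts, and invariance of the basic spaces. -/

/-- The chain rule for `μ.symm ∘ μ = id`. Its pointwise form below supplies the cancellation at the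
base point in `spreadDens_pull`. -/
theorem der_diffeo_symm_comp (p : M) :
    (der μ.symm (μ p)).comp (der μ p) = ContinuousLinearMap.id ℝ (Vec n) := by
  rw [← der_comp _ _ _ (mdiff_diffeo μ.symm _) (mdiff_diffeo μ p), ← der_id p]
  exact der_congr (Filter.Eventually.of_forall μ.symm_apply_apply)

theorem der_diffeo_symm_apply (p : M) (w : Vec n) : der μ.symm (μ p) (der μ p w) = w :=
  congrArg (fun L : Vec n →L[ℝ] Vec n => L w) (der_diffeo_symm_comp μ p)

/-- In the chart `e` of `M`, the pull-back of a tensor at `μ p` has the same representative as the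
tensor has in the chart `e ∘ μ⁻¹` of `N`. -/
theorem triv_tensorAct (r s : ℕ) (e : Chart n M) {p : M} (hp : p ∈ e.1.source)
    (u : TensorVal n r s ℝ) :
    ((tensorFib n r s).atlas M).triv e (e.1 p) (tensorAct (der μ p) (der μ.symm (μ p)) u) =
      ((tensorFib n r s).atlas N).triv (chartPull μ e) ((chartPull μ e).1 (μ p)) u := by
  -- `iso_rep` concerns sections but uses no smoothness, and only the value at `μ p` matters, so the
  -- set-theoretically constant section `u` serves. The factor is `1` because tensors, unlike
  -- densities, carry no orientation sign.
  have h := iso_rep μ (tensorFib n r s) (fun _ => 1) e (e.1.map_source hp) (fun _ => u)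
  -- The two charts give `p` and `μ p` the same coordinates, so both trivializations are taken over
  -- the same point of `ℝⁿ`.
  have hx : (chartPull μ e).1 (μ p) = e.1 p := congrArg e.1 (μ.symm_apply_apply p)
  rw [hx]
  simp only [one_smul, VBAtlas.rep] at h
  change ((tensorFib n r s).atlas M).triv e (e.1 p)
    (tensorAct (der μ (e.1.symm (e.1 p))) (der μ.symm (μ (e.1.symm (e.1 p)))) u) = _ at h
  rwa [e.1.left_inv hp] at h

/-- `μ̂^*` preserves the basic spaces. -/
theorem IsBasic.pull (τM : OrientationForm n M) (τN : OrientationForm n N) {r s : ℕ}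
    {u : GenField τN r s} (hu : IsBasic τN r s u) :
    IsBasic τM r s (GenField.pull μ τM τN u) := by
  intro η p A hη hp hA e
  -- Smoothness of `u` along the pushed-forward curve. Push-forward is pull-back along `μ.symm`, and
  -- the result is read in the chart of `N` that corresponds to `e`.
  have h := hu (fun t => UnitForm.pull μ.symm τN τM (η t)) (fun t => μ (p t))
    (fun t => CTransport.pull μ.symm (A t))
    (VBAtlas.Iso.isSmoothCurve_pull ((formFib n).iso μ.symm τN τM) hη)
    (μ.contMDiff.comp hp) (VBAtlas.Iso.isSmoothCurve_pull (transportIso μ.symm) hA) (chartPull μ e)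
  -- The curves `p` and `μ ∘ p` lie in the corresponding chart domains at the same times.
  have hs : {t | μ (p t) ∈ (chartPull μ e).1.source} = {t | p t ∈ e.1.source} := by
    ext t
    change μ.symm (μ (p t)) ∈ e.1.source ↔ _
    rw [μ.symm_apply_apply]
    rfl
  rw [hs] at h
  exact h.congr fun t ht => triv_tensorAct μ r s e ht _

/-! ### Compatibility with the embedding of tensor distributions. -/

/-- Spreading the push-forward of `t` by the push-forwards of `η` and `A` gives the push-forward of
the density spread from `t`. -/
theorem spreadDens_pull (τM : OrientationForm n M) (τN : OrientationForm n N) {r s : ℕ}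
    (η : CForms n M) (A : CTransport n M) (p : M) (w : Fin s → Vec n) (β : Fin r → Covec n) :
    spreadDens (CForms.pull μ.symm τN τM η) (CTransport.pull μ.symm A) (μ p)
        (decomp (fun j => der μ p (w j)) (fun i => (β i).comp (der μ.symm (μ p)))) =
      CDens.pull μ.symm τN τM s r (spreadDens η A p (decomp w β)) := by
  -- At `q` the density is tested on covectors `α`, vectors `u` and a frame `v`. On the left the
  -- sign sits with the form, on the right in front of the whole density.
  ext q α u v
  change decomp (fun j => der μ p (w j)) (fun i => (β i).comp (der μ.symm (μ p)))
      (fun i => (α i).comp ((der μ (μ.symm q)).comp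
        ((A.1 (μ.symm (μ p), μ.symm q)).comp (der μ.symm (μ p)))))
      (fun j => ((der μ (μ.symm (μ p))).comp
        ((A.1 (μ.symm q, μ.symm (μ p))).comp (der μ.symm q))) (u j)) *
      (sgn μ.symm τN τM q * η.1 (μ.symm q) (fun i => der μ.symm q (v i))) =
    sgn μ.symm τN τM q * (decomp w β
      (fun i => ((α i).comp (der μ (μ.symm q))).comp (A.1 (p, μ.symm q)))
      (fun j => A.1 (μ.symm q, p) (der μ.symm q (u j))) *
      η.1 (μ.symm q) (fun i => der μ.symm q (v i)))
  rw [μ.symm_apply_apply, decomp_apply, decomp_apply]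
  -- In each factor with `α i`, the inner `T_{μ p}μ⁻¹` of the conjugated operator meets `T_pμ (w
  -- i)`; in each factor with `β j`, the covector's `T_{μ p}μ⁻¹` meets the outer `T_pμ`. The tangent
  -- maps at `q` and `μ⁻¹ q` agree on both sides, so only the position of the sign is left to
  -- `ring`.
  simp only [ContinuousLinearMap.comp_apply, der_diffeo_symm_apply]
  ring

/-- `μ̂^*` commutes with the embeddings of tensor distributions. -/
theorem GenField.pull_iota (τM : OrientationForm n M) (τN : OrientationForm n N) {r s : ℕ}
    (v : TensorDistribution n N r s) :
    GenField.pull μ τM τN (iota τN v) = iota τM (TensorDistribution.pull μ τM τN v) := by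
  funext η p A
  ext β w
  -- `ofFunctional` evaluates its functional only on decomposable tensors, so these suffice. By
  -- definition `tensorAct` replaces `(β, w)` by `(β ∘ T_{μ p}μ⁻¹, T_pμ w)`, and the pulled-back
  -- distribution is `v` after push-forward of densities.
  exact congrArg v.toFun (spreadDens_pull μ τM τN η.1 A p w β)

end Manifold
end TensorDist

theorem mainTheorem11 {n : ℕ} {M N : Type*}
    [TopologicalSpace M] [T2Space M] [ParacompactSpace M]
    [ChartedSpace (EuclideanSpace ℝ (Fin n)) M] [IsManifold (𝓡 n) ∞ M]
    [TopologicalSpace N] [T2Space N] [ParacompactSpace N]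
    [ChartedSpace (EuclideanSpace ℝ (Fin n)) N] [IsManifold (𝓡 n) ∞ N]
    (τM : TensorDist.OrientationForm n M) (τN : TensorDist.OrientationForm n N)
    (μ : M ≃ₘ⟮𝓡 n, 𝓡 n⟯ N) (r s : ℕ) :
    (∀ u : TensorDist.GenField τN r s, TensorDist.IsBasic τN r s u →
      TensorDist.IsBasic τM r s (TensorDist.GenField.pull μ τM τN u)) ∧
    ∀ v : TensorDist.TensorDistribution n N r s,
      TensorDist.GenField.pull μ τM τN (TensorDist.iota τN v) =
        TensorDist.iota τM (TensorDist.TensorDistribution.pull μ τM τN v) := by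
  exact ⟨fun _ hu => hu.pull μ τM τN, TensorDist.GenField.pull_iota μ τM τN⟩
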